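/- Let $\Delta=\{\zeta\in\mathbb C:|\zeta|<1\}$ and let $d_\Delta(\zeta,\zeta')=\operatorname{artanh}\left|\frac{\zeta-\zeta'}{1-\overline{\zeta'}\,\zeta}\right|$ be the Poincaré distance on $\Delta$. For $k\ge 0$, a map $f:\Delta\to\mathbb C$ of class $\mathcal C^1$ (in the real sense) is called $k$-quasiconformal if $\left|\frac{\partial f}{\partial\bar\zeta}(z)\right|\le k\left|\frac{\partial f}{\partial\zeta}(z)\right|$ for all $z\in\Delta$. Let $0\le k<1$. Then every $k$-quasiconformal homeomorphism of $\Delta$ onto itself is a quasi-isometry for $d_\Delta$, with constants depending only on $k$: there exist $\lambda>0$ and $c>0$, depending only on $k$, such that for every homeomorphism $f:\Delta\to\Delta$ of class $\mathcal C^1$ which is $k$-quasiconformal and for all $\zeta,\zeta'\in\Delta$, $$\frac1\lambda\,d_\Delta(\zeta,\zeta')-c\ \le\ d_\Delta(f(\zeta),f(\zeta'))\ \le\ \lambda\,d_\Delta(\zeta,\zeta')+c .$$ -/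

import Mathlib

noncomputable section

/-- The open unit disc `Δ` in the complex plane. -/
def unitDisc : Set ℂ := Metric.ball 0 1

/-- The Poincaré distance on the unit disc, the distance of the Riemannian metric
`|dz|² / (1 - |z|²)²`: it is `artanh |(z - w) / (1 - conj w * z)|`. -/
def poincareDist (z w : ℂ) : ℝ :=
  Real.artanh ‖(z - w) / (1 - (starRingEnd ℂ) w * z)‖

/-- The derivative `∂f/∂ζ = (∂f/∂x - i ∂f/∂y) / 2`. -/
def wirtinger (f : ℂ → ℂ) (z : ℂ) : ℂ :=
  (fderiv ℝ f z 1 - Complex.I * fderiv ℝ f z Complex.I) / 2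

/-- The derivative `∂f/∂ζ̄ = (∂f/∂x + i ∂f/∂y) / 2`. -/
def wirtingerBar (f : ℂ → ℂ) (z : ℂ) : ℂ :=
  (fderiv ℝ f z 1 + Complex.I * fderiv ℝ f z Complex.I) / 2

/-- `f` is of class `C¹` (in the real sense) and `k`-quasiconformal on the domain `Ω`. -/
structure IsQuasiconformalOn (k : ℝ) (f : ℂ → ℂ) (Ω : Set ℂ) : Prop where
  contDiffOn : ContDiffOn ℝ 1 f Ω
  norm_wirtingerBar_le : ∀ z ∈ Ω, ‖wirtingerBar f z‖ ≤ k * ‖wirtinger f z‖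

/-- `f`, viewed as a map on the set `S` with distance `d`, with values in a space with
distance `d'`, satisfies the two inequalities of a quasi-isometry with constants `lam` and `c`. -/
def IsQuasiIsometryOnWith {X Y : Type*} (d : X → X → ℝ) (d' : Y → Y → ℝ)
    (lam c : ℝ) (f : X → Y) (S : Set X) : Prop :=
  ∀ x ∈ S, ∀ y ∈ S,
    1 / lam * d x y - c ≤ d' (f x) (f y) ∧ d' (f x) (f y) ≤ lam * d x y + c

end

/-! A `k`-quasiconformal `F` satisfies `‖DF‖² ≤ K det DF` with `K = (1 + k) / (1 - k)`. This
survives composition with disc automorphisms on either side, so any two points can be moved to a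
normal position with `F 0 = 0`. Cutting geodesics into pieces of length `δ = artanh (1/2)`
(`poincareDist_le_of_local`) leaves two bounds at one scale: points at distance at most `δ` have
images at bounded distance, and conversely. The converse is not the first bound applied to the
inverse: `DF` may vanish, so the inverse need not be `C¹`.

Both bounds come from the length-area method: if the images of arcs of concentric circles of radii
in `(a, b)` have length at least `l`, then `l² log (b / a) / (2π)` is at most the energy, hence at
most `K` times the image area. In `log_estimate_image` the circles are centred at `0` and the image
is measured after a logarithm with branch point just outside the disc near `F z`; the squared length
then outgrows the area. In `log_estimate_preimage` the circles are centred at the boundary point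
`-1`, and each contains an arc from the preimage of a compact segment out towards the unit circle,
where `|F|` is large. -/

open MeasureTheory Set Filter Topology

open scoped ComplexConjugate

/-! ### The length-area inequality. -/

/-- The square of the integral of a continuous function is at most the length of the interval
times the integral of the square. -/
theorem sq_integral_le_mul_integral_sq {q : ℝ → ℝ} {a b : ℝ} (hab : a ≤ b)
    (hq : ContinuousOn q (Icc a b)) :
    (∫ t in a..b, q t) ^ 2 ≤ (b - a) * ∫ t in a..b, q t ^ 2 := by
  rw [← uIcc_of_le hab] at hq
  rcases hab.eq_or_lt with rfl | hlt
  · simp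
  have hi1 : IntervalIntegrable q volume a b := hq.intervalIntegrable
  have hi2 : IntervalIntegrable (fun t => q t ^ 2) volume a b := (hq.pow 2).intervalIntegrable
  -- `m` is the mean of `q`; the claim is that the variance is nonnegative.
  set m : ℝ := (∫ t in a..b, q t) / (b - a) with hm
  have h0 : 0 ≤ ∫ t in a..b, (q t - m) ^ 2 :=
    intervalIntegral.integral_nonneg hab fun t _ => sq_nonneg _
  have h1 : ∫ t in a..b, (q t - m) ^ 2
      = (∫ t in a..b, q t ^ 2) - 2 * m * (∫ t in a..b, q t) + (b - a) * m ^ 2 := by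
    have : (fun t => (q t - m) ^ 2) = fun t => (q t ^ 2 - 2 * m * q t) + m ^ 2 := by
      funext t; ring
    rw [this, intervalIntegral.integral_add (hi2.sub (hi1.const_mul _)) (by simp),
      intervalIntegral.integral_sub hi2 (hi1.const_mul _)]
    simp
  have hpos : 0 < b - a := sub_pos.2 hlt
  have h2 : (∫ t in a..b, q t) = m * (b - a) := by rw [hm]; field_simp
  rw [h1, h2] at h0
  rw [h2]
  nlinarith

/-- Length-area inequality along one arc of a circle. -/
theorem arc_length_area {g : ℂ → ℂ} {U : Set ℂ} (hU : IsOpen U) (hg : ContDiffOn ℝ 1 g U)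
    {p : ℂ} {r l s t : ℝ} (hr : 0 < r) (hl : 0 ≤ l)
    (hs : s ∈ Icc (-Real.pi) Real.pi) (ht : t ∈ Icc (-Real.pi) Real.pi)
    (harc : ∀ x ∈ uIcc s t, circleMap p r x ∈ U)
    (hdist : l ≤ ‖g (circleMap p r s) - g (circleMap p r t)‖) :
    ENNReal.ofReal (l ^ 2 / (2 * Real.pi * r)) ≤
      ∫⁻ x in Ioo (-Real.pi) Real.pi, ENNReal.ofReal r *
        U.indicator (fun z => ENNReal.ofReal (‖fderiv ℝ g z‖ ^ 2)) (circleMap p r x) := by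
  wlog hst : s ≤ t generalizing s t
  · exact this ht hs (by rwa [uIcc_comm]) (by rwa [norm_sub_rev]) (le_of_not_ge hst)
  rw [uIcc_of_le hst] at harc
  set D : ℝ → ℝ := fun x => ‖fderiv ℝ g (circleMap p r x)‖ with hD
  have hDc : ContinuousOn D (Icc s t) := by
    have h1 : ContinuousOn (fderiv ℝ g) U := hg.continuousOn_fderiv_of_isOpen hU le_rfl
    exact (h1.comp (continuous_circleMap p r).continuousOn harc).norm
  have hderiv : ∀ x ∈ Icc s t, HasDerivAt (fun x => g (circleMap p r x))
      (fderiv ℝ g (circleMap p r x) (circleMap 0 r x * Complex.I)) x := by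
    intro x hx
    have h1 : HasFDerivAt g (fderiv ℝ g (circleMap p r x)) (circleMap p r x) :=
      ((hg.differentiableOn one_ne_zero).differentiableAt
        (hU.mem_nhds (harc x hx))).hasFDerivAt
    exact h1.comp_hasDerivAt x (hasDerivAt_circleMap p r x)
  have hcont' : ContinuousOn (fun x => fderiv ℝ g (circleMap p r x)
      (circleMap 0 r x * Complex.I)) (Icc s t) := by
    have h1 : ContinuousOn (fderiv ℝ g) U := hg.continuousOn_fderiv_of_isOpen hU le_rfl
    refine (h1.comp (continuous_circleMap p r).continuousOn harc).clm_apply ?_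
    exact ((continuous_circleMap 0 r).mul continuous_const).continuousOn
  have hftc := intervalIntegral.integral_eq_sub_of_hasDerivAt (a := s) (b := t)
    (by rw [uIcc_of_le hst]; exact hderiv)
    (by rw [← uIcc_of_le hst] at hcont'; exact hcont'.intervalIntegrable)
  have hlen : l ≤ r * ∫ x in s..t, D x := by
    calc l ≤ ‖g (circleMap p r t) - g (circleMap p r s)‖ := by rwa [norm_sub_rev]
      _ ≤ ∫ x in s..t, r * D x := by
        rw [← hftc]
        refine intervalIntegral.norm_integral_le_of_norm_le hst ?_ ?_
        · refine Eventually.of_forall fun x _ => ?_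
          refine (ContinuousLinearMap.le_opNorm _ _).trans (le_of_eq ?_)
          simp [hD, abs_of_pos hr, mul_comm]
        · rw [← uIcc_of_le hst] at hDc
          exact (hDc.intervalIntegrable).const_mul _
      _ = r * ∫ x in s..t, D x := by simp
  have hsq := sq_integral_le_mul_integral_sq hst hDc
  have hI0 : 0 ≤ ∫ x in s..t, D x ^ 2 := intervalIntegral.integral_nonneg hst fun _ _ => sq_nonneg _
  -- Cauchy–Schwarz on an angular interval of length at most `2π`; dividing by `2πr` leaves one
  -- factor `r`, the polar area density.
  have hkey : l ^ 2 / (2 * Real.pi * r) ≤ r * ∫ x in s..t, D x ^ 2 := by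
    rw [div_le_iff₀ (by positivity)]
    have h1 : l ^ 2 ≤ (r * ∫ x in s..t, D x) ^ 2 := pow_le_pow_left₀ hl hlen 2
    have h2 : t - s ≤ 2 * Real.pi := by linarith [hs.1, ht.2]
    have h3 := mul_le_mul_of_nonneg_right h2 hI0
    calc l ^ 2 ≤ r ^ 2 * (∫ x in s..t, D x) ^ 2 := by rwa [mul_pow] at h1
      _ ≤ r ^ 2 * (2 * Real.pi * ∫ x in s..t, D x ^ 2) :=
        mul_le_mul_of_nonneg_left (hsq.trans h3) (sq_nonneg r)
      _ = _ := by ring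
  have hint : IntegrableOn (fun x => D x ^ 2) (Ioc s t) := by
    exact ((hDc.pow 2).integrableOn_Icc).mono_set Ioc_subset_Icc_self
  calc ENNReal.ofReal (l ^ 2 / (2 * Real.pi * r))
      ≤ ENNReal.ofReal (r * ∫ x in s..t, D x ^ 2) := ENNReal.ofReal_le_ofReal hkey
    _ = ENNReal.ofReal r * ∫⁻ x in Ioo s t, ENNReal.ofReal (D x ^ 2) := by
      rw [ENNReal.ofReal_mul hr.le, intervalIntegral.integral_of_le hst,
        ofReal_integral_eq_lintegral_ofReal hint (Eventually.of_forall fun _ => sq_nonneg _),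
        setLIntegral_congr Ioo_ae_eq_Ioc]
    _ = ∫⁻ x in Ioo s t, ENNReal.ofReal r * ENNReal.ofReal (D x ^ 2) := by
      rw [lintegral_const_mul' _ _ ENNReal.ofReal_ne_top]
    _ = ∫⁻ x in Ioo s t, ENNReal.ofReal r *
        U.indicator (fun z => ENNReal.ofReal (‖fderiv ℝ g z‖ ^ 2)) (circleMap p r x) := by
      refine setLIntegral_congr_fun measurableSet_Ioo fun x hx => ?_
      simp only [indicator_of_mem (harc x (Ioo_subset_Icc_self hx)), hD]
    _ ≤ _ := lintegral_mono_set (Ioo_subset_Ioo hs.1 ht.2)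

/-- Length-area inequality: if on each circle of centre `p` and radius in `(a, b)` some arc inside
`U` has end points whose images are at distance at least `l`, then the Dirichlet energy of the map
on `U` is at least `l² log (b / a) / (2π)`. -/
theorem length_area {g : ℂ → ℂ} {U : Set ℂ} (hU : IsOpen U) (hg : ContDiffOn ℝ 1 g U)
    {p : ℂ} {a b l : ℝ} (ha : 0 < a) (hab : a ≤ b) (hl : 0 ≤ l)
    (harc : ∀ r ∈ Ioo a b, ∃ s ∈ Icc (-Real.pi) Real.pi, ∃ t ∈ Icc (-Real.pi) Real.pi,
      (∀ x ∈ uIcc s t, circleMap p r x ∈ U) ∧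
        l ≤ ‖g (circleMap p r s) - g (circleMap p r t)‖) :
    ENNReal.ofReal (l ^ 2 / (2 * Real.pi) * Real.log (b / a)) ≤
      ∫⁻ z in U, ENNReal.ofReal (‖fderiv ℝ g z‖ ^ 2) := by
  set h : ℂ → ENNReal := U.indicator (fun z => ENNReal.ofReal (‖fderiv ℝ g z‖ ^ 2)) with hh
  have hmeas : Measurable h := by
    refine Measurable.indicator ?_ hU.measurableSet
    exact ((measurable_fderiv ℝ g).norm.pow_const 2).ennreal_ofReal
  have hint : ∫⁻ r in Ioo a b, ENNReal.ofReal (l ^ 2 / (2 * Real.pi * r))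
      = ENNReal.ofReal (l ^ 2 / (2 * Real.pi) * Real.log (b / a)) := by
    have hc : ContinuousOn (fun r : ℝ => l ^ 2 / (2 * Real.pi * r)) (Icc a b) := by
      refine continuousOn_const.div (by fun_prop) fun x hx => ?_
      have := ha.trans_le hx.1
      positivity
    rw [setLIntegral_congr Ioo_ae_eq_Ioc, ← ofReal_integral_eq_lintegral_ofReal
      (hc.integrableOn_Icc.mono_set Ioc_subset_Icc_self), ← intervalIntegral.integral_of_le hab]
    · congr 1
      rw [← integral_one_div_of_pos ha (ha.trans_le hab), ← intervalIntegral.integral_const_mul]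
      congr 1
      funext r
      field_simp
    · refine (ae_restrict_iff' measurableSet_Ioc).2 (Eventually.of_forall fun r hr => ?_)
      have := ha.trans hr.1
      simp only [Pi.zero_apply]
      positivity
  have hpolar : ∀ q : ℝ × ℝ, p + Complex.polarCoord.symm q = circleMap p q.1 q.2 := by
    intro q
    simp [circleMap, Complex.exp_mul_I]
  have hmeas2 : Measurable fun q : ℝ × ℝ => ENNReal.ofReal q.1 * h (circleMap p q.1 q.2) := by
    refine (measurable_fst.ennreal_ofReal).mul (hmeas.comp ?_)
    unfold circleMap
    fun_prop
  calc ENNReal.ofReal (l ^ 2 / (2 * Real.pi) * Real.log (b / a))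
      = ∫⁻ r in Ioo a b, ENNReal.ofReal (l ^ 2 / (2 * Real.pi * r)) := hint.symm
    _ ≤ ∫⁻ r in Ioo a b, ∫⁻ x in Ioo (-Real.pi) Real.pi,
          ENNReal.ofReal r * h (circleMap p r x) := by
      refine setLIntegral_mono' measurableSet_Ioo fun r hr => ?_
      obtain ⟨s, hs, t, ht, h1, h2⟩ := harc r hr
      exact arc_length_area hU hg (ha.trans hr.1) hl hs ht h1 h2
    _ ≤ ∫⁻ r in Ioi 0, ∫⁻ x in Ioo (-Real.pi) Real.pi,
          ENNReal.ofReal r * h (circleMap p r x) :=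
      lintegral_mono_set fun r hr => ha.trans hr.1
    _ = ∫⁻ q in polarCoord.target, ENNReal.ofReal q.1 • h (p + Complex.polarCoord.symm q) := by
      simp_rw [hpolar, smul_eq_mul]
      rw [polarCoord_target, Measure.volume_eq_prod, setLIntegral_prod _ hmeas2.aemeasurable]
    _ = ∫⁻ z, h (p + z) := Complex.lintegral_comp_polarCoord_symm fun z => h (p + z)
    _ = ∫⁻ z, h z := lintegral_add_left_eq_self h p
    _ = _ := lintegral_indicator hU.measurableSet _

/-- The Dirichlet energy of an injective map with bounded distortion is controlled by the area of
its image. -/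
theorem lintegral_norm_fderiv_sq_le {g : ℂ → ℂ} {U : Set ℂ} (hU : IsOpen U)
    (hg : ContDiffOn ℝ 1 g U) (hinj : InjOn g U) {K : ℝ} (hK : 0 ≤ K)
    (hdist : ∀ z ∈ U, ‖fderiv ℝ g z‖ ^ 2 ≤ K * (fderiv ℝ g z).det) :
    ∫⁻ z in U, ENNReal.ofReal (‖fderiv ℝ g z‖ ^ 2) ≤ ENNReal.ofReal K * volume (g '' U) := by
  rw [← lintegral_abs_det_fderiv_eq_addHaar_image volume hU.measurableSet (fun z hz =>
    ((hg.differentiableOn one_ne_zero).differentiableAt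
      (hU.mem_nhds hz)).hasFDerivAt.hasFDerivWithinAt) hinj,
    ← lintegral_const_mul' _ _ ENNReal.ofReal_ne_top]
  refine setLIntegral_mono' hU.measurableSet fun z hz => ?_
  rw [← ENNReal.ofReal_mul hK]
  exact ENNReal.ofReal_le_ofReal ((hdist z hz).trans
    (mul_le_mul_of_nonneg_left (le_abs_self _) hK))

/-! ### Automorphisms of the disc and their action on the Poincaré distance. -/

theorem mem_unitDisc {z : ℂ} : z ∈ unitDisc ↔ ‖z‖ < 1 := by simp [unitDisc]

theorem isOpen_unitDisc : IsOpen unitDisc := Metric.isOpen_ball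

theorem zero_mem_unitDisc : (0 : ℂ) ∈ unitDisc := by simp [unitDisc]

theorem one_sub_conj_mul_ne_zero {z w : ℂ} (hz : z ∈ unitDisc) (hw : w ∈ unitDisc) :
    1 - conj w * z ≠ 0 := by
  intro h
  have h1 : ‖conj w * z‖ = 1 := by rw [← sub_eq_zero.1 h]; simp
  rw [norm_mul, Complex.norm_conj] at h1
  nlinarith [mem_unitDisc.1 hz, mem_unitDisc.1 hw, norm_nonneg z, norm_nonneg w]

/-- The identity behind the invariance of the disc under its Möbius automorphisms. -/
theorem norm_one_sub_conj_mul_sq (z w : ℂ) :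
    ‖1 - conj w * z‖ ^ 2 = ‖z - w‖ ^ 2 + (1 - ‖z‖ ^ 2) * (1 - ‖w‖ ^ 2) := by
  simp only [← Complex.normSq_eq_norm_sq, Complex.normSq_apply]
  simp
  ring

theorem norm_div_lt_one {z w : ℂ} (hz : z ∈ unitDisc) (hw : w ∈ unitDisc) :
    ‖(z - w) / (1 - conj w * z)‖ < 1 := by
  have h0 := norm_pos_iff.2 (one_sub_conj_mul_ne_zero hz hw)
  rw [norm_div, div_lt_one h0]
  refine lt_of_pow_lt_pow_left₀ 2 h0.le ?_
  rw [norm_one_sub_conj_mul_sq]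
  have h1 : ‖z‖ ^ 2 < 1 := by
    have := mem_unitDisc.1 hz
    exact pow_lt_one₀ (norm_nonneg _) this two_ne_zero
  have h2 : ‖w‖ ^ 2 < 1 := by
    have := mem_unitDisc.1 hw
    exact pow_lt_one₀ (norm_nonneg _) this two_ne_zero
  have := mul_pos (sub_pos.2 h1) (sub_pos.2 h2)
  linarith

theorem poincareDist_comm (z w : ℂ) : poincareDist z w = poincareDist w z := by
  unfold poincareDist
  congr 1
  rw [norm_div, norm_div, norm_sub_rev z w, ← Complex.norm_conj (1 - conj w * z)]
  simp [mul_comm]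

theorem poincareDist_nonneg (z w : ℂ) : 0 ≤ poincareDist z w :=
  Real.artanh_nonneg (norm_nonneg _)

@[simp]
theorem poincareDist_zero_left (z : ℂ) : poincareDist 0 z = Real.artanh ‖z‖ := by
  simp [poincareDist]

/-- `A` is a holomorphic automorphism of the unit disc with inverse `B`, and an isometry for the
Poincaré distance. -/
structure IsDiscAut (A B : ℂ → ℂ) : Prop where
  mapsTo : MapsTo A unitDisc unitDisc
  mapsTo_inv : MapsTo B unitDisc unitDisc
  left_inv : ∀ z ∈ unitDisc, B (A z) = z
  right_inv : ∀ z ∈ unitDisc, A (B z) = z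
  holo : DifferentiableOn ℂ A unitDisc
  holo_inv : DifferentiableOn ℂ B unitDisc
  dist_eq : ∀ z ∈ unitDisc, ∀ w ∈ unitDisc, poincareDist (A z) (A w) = poincareDist z w

theorem IsDiscAut.symm {A B : ℂ → ℂ} (h : IsDiscAut A B) : IsDiscAut B A where
  mapsTo := h.mapsTo_inv
  mapsTo_inv := h.mapsTo
  left_inv := h.right_inv
  right_inv := h.left_inv
  holo := h.holo_inv
  holo_inv := h.holo
  dist_eq z hz w hw := by
    rw [← h.dist_eq _ (h.mapsTo_inv hz) _ (h.mapsTo_inv hw), h.right_inv z hz, h.right_inv w hw]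

theorem IsDiscAut.comp {A B A' B' : ℂ → ℂ} (h : IsDiscAut A B) (h' : IsDiscAut A' B') :
    IsDiscAut (A ∘ A') (B' ∘ B) where
  mapsTo := h.mapsTo.comp h'.mapsTo
  mapsTo_inv := h'.mapsTo_inv.comp h.mapsTo_inv
  left_inv z hz := by simp [h.left_inv _ (h'.mapsTo hz), h'.left_inv z hz]
  right_inv z hz := by simp [h'.right_inv _ (h.mapsTo_inv hz), h.right_inv z hz]
  holo := h.holo.comp h'.holo h'.mapsTo
  holo_inv := h'.holo_inv.comp h.holo_inv h.mapsTo_inv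
  dist_eq z hz w hw := by
    simp [h.dist_eq _ (h'.mapsTo hz) _ (h'.mapsTo hw), h'.dist_eq z hz w hw]

theorem isDiscAut_rotation {u : ℂ} (hu : ‖u‖ = 1) :
    IsDiscAut (fun z => u * z) (fun z => conj u * z) := by
  have h1 : conj u * u = 1 := by
    rw [← Complex.normSq_eq_conj_mul_self, Complex.normSq_eq_norm_sq, hu]; simp
  have hu' : ‖conj u‖ = 1 := by rwa [Complex.norm_conj]
  refine ⟨fun z hz => ?_, fun z hz => ?_, fun z _ => ?_, fun z _ => ?_, by fun_prop, by fun_prop,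
    fun z _ w _ => ?_⟩
  · simpa [mem_unitDisc, hu] using hz
  · simpa [mem_unitDisc, hu] using hz
  · rw [← mul_assoc, h1, one_mul]
  · rw [← mul_assoc, mul_comm u, h1, one_mul]
  · have h2 : conj (u * w) * (u * z) = conj w * z := by
      rw [map_mul]
      linear_combination (conj w * z) * h1
    simp only [poincareDist, h2, ← mul_sub, norm_div, norm_mul, hu, one_mul]

/-- The Möbius automorphism of the disc that sends `a` to `0`. -/
noncomputable def moebius (a z : ℂ) : ℂ := (z - a) / (1 - conj a * z)

theorem neg_mem_unitDisc {a : ℂ} (ha : a ∈ unitDisc) : -a ∈ unitDisc := by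
  simpa [mem_unitDisc] using ha

theorem moebius_mapsTo {a : ℂ} (ha : a ∈ unitDisc) : MapsTo (moebius a) unitDisc unitDisc :=
  fun _ hz => mem_unitDisc.2 (norm_div_lt_one hz ha)

theorem moebius_neg_moebius {a z : ℂ} (ha : a ∈ unitDisc) (hz : z ∈ unitDisc) :
    moebius (-a) (moebius a z) = z := by
  have h1 := one_sub_conj_mul_ne_zero hz ha
  have h2 := one_sub_conj_mul_ne_zero (moebius_mapsTo ha hz) (neg_mem_unitDisc ha)
  have hq : (z - a) / (1 - conj a * z) * (1 - conj a * z) = z - a := div_mul_cancel₀ _ h1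
  unfold moebius at h2 ⊢
  rw [div_eq_iff h2, map_neg]
  linear_combination hq

theorem moebius_differentiableOn {a : ℂ} (ha : a ∈ unitDisc) :
    DifferentiableOn ℂ (moebius a) unitDisc := by
  unfold moebius
  exact DifferentiableOn.div (by fun_prop) (by fun_prop) fun z hz => one_sub_conj_mul_ne_zero hz ha

/-- The quotient inside `artanh` only gains the factor `(1 - a w̄) / (1 - ā w)`, whose numerator and
denominator are conjugate. -/
theorem poincareDist_moebius {a z w : ℂ} (ha : a ∈ unitDisc) (hz : z ∈ unitDisc)
    (hw : w ∈ unitDisc) : poincareDist (moebius a z) (moebius a w) = poincareDist z w := by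
  have h1 := one_sub_conj_mul_ne_zero hz ha
  have h2 := one_sub_conj_mul_ne_zero hw ha
  have h2' : 1 - a * conj w ≠ 0 := by
    have := (map_ne_zero (starRingEnd ℂ)).2 h2
    simpa using this
  have h3 := one_sub_conj_mul_ne_zero ha ha
  have h4 := one_sub_conj_mul_ne_zero hz hw
  have e1 : moebius a z - moebius a w
      = (1 - conj a * a) * (z - w) / ((1 - conj a * z) * (1 - conj a * w)) := by
    rw [moebius, moebius, div_sub_div _ _ h1 h2]
    congr 1
    ring
  have e2 : 1 - conj (moebius a w) * moebius a z
      = (1 - conj a * a) * (1 - conj w * z) / ((1 - a * conj w) * (1 - conj a * z)) := by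
    unfold moebius
    simp only [map_div₀, map_sub, map_one, map_mul, Complex.conj_conj]
    rw [div_mul_div_comm, one_sub_div (mul_ne_zero h2' h1)]
    congr 1
    ring
  have e3 : (moebius a z - moebius a w) / (1 - conj (moebius a w) * moebius a z)
      = (z - w) / (1 - conj w * z) * ((1 - a * conj w) / (1 - conj a * w)) := by
    rw [e1, e2, div_div_div_eq, div_mul_div_comm, div_eq_div_iff]
    · ring
    · exact mul_ne_zero (mul_ne_zero h1 h2) (mul_ne_zero h3 h4)
    · exact mul_ne_zero h4 h2
  have e4 : ‖(1 - a * conj w) / (1 - conj a * w)‖ = 1 := by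
    rw [norm_div, ← Complex.norm_conj (1 - a * conj w)]
    simp only [map_sub, map_one, map_mul, Complex.conj_conj]
    exact div_self (norm_ne_zero_iff.2 h2)
  unfold poincareDist
  rw [e3, norm_mul, e4, mul_one]

theorem isDiscAut_moebius {a : ℂ} (ha : a ∈ unitDisc) :
    IsDiscAut (moebius a) (moebius (-a)) where
  mapsTo := moebius_mapsTo ha
  mapsTo_inv := moebius_mapsTo (neg_mem_unitDisc ha)
  left_inv _ hz := moebius_neg_moebius ha hz
  right_inv z hz := by simpa using moebius_neg_moebius (neg_mem_unitDisc ha) hz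
  holo := moebius_differentiableOn ha
  holo_inv := moebius_differentiableOn (neg_mem_unitDisc ha)
  dist_eq _ hz _ hw := poincareDist_moebius ha hz hw

theorem tanh_poincareDist {z w : ℂ} (hz : z ∈ unitDisc) (hw : w ∈ unitDisc) :
    Real.tanh (poincareDist z w) = ‖(z - w) / (1 - conj w * z)‖ :=
  Real.tanh_artanh ⟨by linarith [norm_nonneg ((z - w) / (1 - conj w * z))], norm_div_lt_one hz hw⟩

/-- The automorphisms of the disc act transitively on pairs of points at a given distance. -/
theorem exists_isDiscAut {z w u : ℂ} (hz : z ∈ unitDisc) (hw : w ∈ unitDisc)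
    (hu : ‖u‖ = Real.tanh (poincareDist z w)) :
    ∃ A B, IsDiscAut A B ∧ A 0 = z ∧ A u = w := by
  set v := moebius z w with hv
  have hvd : v ∈ unitDisc := moebius_mapsTo hz hw
  have huv : ‖u‖ = ‖v‖ := by
    rw [hu, poincareDist_comm, tanh_poincareDist hw hz, hv, moebius]
  have hback : moebius (-z) v = w := moebius_neg_moebius hz hw
  have hzero : moebius (-z) 0 = z := by simp [moebius]
  obtain ⟨c, hc, hcu⟩ : ∃ c : ℂ, ‖c‖ = 1 ∧ c * u = v := by
    by_cases hu0 : u = 0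
    · have : v = 0 := by rw [← norm_eq_zero, ← huv, hu0, norm_zero]
      exact ⟨1, by simp, by simp [this, hu0]⟩
    · exact ⟨v / u, by rw [norm_div, huv, div_self]; rw [← huv]; exact norm_ne_zero_iff.2 hu0,
        div_mul_cancel₀ _ hu0⟩
  exact ⟨_, _, (isDiscAut_moebius (neg_mem_unitDisc hz)).comp (isDiscAut_rotation hc),
    by simp [hzero], by simp [hcu, hback]⟩

/-! ### Triangle inequality, geodesics and chaining. -/

theorem artanh_add {a b : ℝ} (ha : 0 ≤ a) (ha1 : a < 1) (hb : 0 ≤ b) (hb1 : b < 1) :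
    Real.artanh a + Real.artanh b = Real.artanh ((a + b) / (1 + a * b)) := by
  have hab : 0 < 1 + a * b := by positivity
  have h1 : (a + b) / (1 + a * b) ≤ 1 := by
    rw [div_le_one hab]; nlinarith
  have h0 : 0 ≤ (a + b) / (1 + a * b) := by positivity
  have h2 : 0 < 1 - a := by linarith
  have h3 : 0 < 1 - b := by linarith
  have h4 : 1 + a * b - (a + b) ≠ 0 := by
    have : 1 + a * b - (a + b) = (1 - a) * (1 - b) := by ring
    rw [this]; positivity
  rw [Real.artanh_eq_half_log ⟨by linarith, by linarith⟩,
    Real.artanh_eq_half_log ⟨by linarith, by linarith⟩,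
    Real.artanh_eq_half_log ⟨by linarith, h1⟩, ← mul_add,
    ← Real.log_mul (by positivity) (by positivity)]
  congr 2
  rw [one_add_div hab.ne', one_sub_div hab.ne', div_div_div_cancel_right₀ hab.ne',
    div_mul_div_comm]
  congr 1 <;> ring

/-- With `P = (1 - |z|²)(1 - |w|²)` and `N = |1 - w̄ z|²`, the squared quotient is `1 - P / N`,
which increases with `N`. At the largest possible value `N = (1 + |z||w|)²` it is the square of
`(|z| + |w|) / (1 + |z||w|)`, the sum given by `artanh_add`. -/
theorem poincareDist_le_add_norm {z w : ℂ} (hz : z ∈ unitDisc) (hw : w ∈ unitDisc) :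
    poincareDist z w ≤ Real.artanh ‖z‖ + Real.artanh ‖w‖ := by
  have hz1 := mem_unitDisc.1 hz
  have hw1 := mem_unitDisc.1 hw
  have hz0 := norm_nonneg z
  have hw0 := norm_nonneg w
  rw [artanh_add hz0 hz1 hw0 hw1]
  have hpos : 0 < 1 + ‖z‖ * ‖w‖ := by positivity
  have hne := norm_pos_iff.2 (one_sub_conj_mul_ne_zero hz hw)
  refine Real.artanh_le_artanh (by linarith [norm_nonneg ((z - w) / (1 - conj w * z))]) ?_ ?_
  · rw [div_lt_one hpos]; nlinarith
  · have hid := norm_one_sub_conj_mul_sq z w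
    have hle : ‖1 - conj w * z‖ ≤ 1 + ‖z‖ * ‖w‖ := by
      refine (norm_sub_le _ _).trans ?_
      simp [mul_comm]
    have hP : 0 ≤ (1 - ‖z‖ ^ 2) * (1 - ‖w‖ ^ 2) :=
      mul_nonneg (by nlinarith) (by nlinarith)
    rw [norm_div, div_le_div_iff₀ hne hpos]
    refine le_of_sq_le_sq ?_ (by positivity)
    have hsq : ‖1 - conj w * z‖ ^ 2 ≤ (1 + ‖z‖ * ‖w‖) ^ 2 := pow_le_pow_left₀ hne.le hle 2
    have hmul := mul_le_mul_of_nonneg_left hsq hP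
    have hM : ‖z - w‖ ^ 2 = ‖1 - conj w * z‖ ^ 2 - (1 - ‖z‖ ^ 2) * (1 - ‖w‖ ^ 2) := by
      linarith
    rw [mul_pow, mul_pow, hM]
    linear_combination hmul

theorem poincareDist_triangle {x y z : ℂ} (hx : x ∈ unitDisc) (hy : y ∈ unitDisc)
    (hz : z ∈ unitDisc) : poincareDist x z ≤ poincareDist x y + poincareDist y z := by
  have hA := isDiscAut_moebius hy
  have h0 : moebius y y = 0 := by simp [moebius]
  rw [poincareDist_comm x y, ← hA.dist_eq x hx z hz, ← hA.dist_eq y hy x hx,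
    ← hA.dist_eq y hy z hz, h0, poincareDist_zero_left, poincareDist_zero_left]
  exact poincareDist_le_add_norm (hA.mapsTo hx) (hA.mapsTo hz)

/-- An automorphism carries `0` to `x` and `tanh D` to `y`; the real segment between them is
geodesic by `artanh_add`, so the image of `tanh s` divides the distance as required. -/
theorem exists_mem_unitDisc_between {x y : ℂ} (hx : x ∈ unitDisc) (hy : y ∈ unitDisc) {s : ℝ} (hs0 : 0 ≤ s)
    (hs : s ≤ poincareDist x y) :
    ∃ m ∈ unitDisc, poincareDist x m = s ∧ poincareDist m y = poincareDist x y - s := by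
  set D := poincareDist x y with hD
  have htanh : ∀ t : ℝ, 0 ≤ t → 0 ≤ Real.tanh t := fun t ht => by
    rw [Real.tanh_eq_sinh_div_cosh]
    exact div_nonneg (Real.sinh_nonneg_iff.2 ht) (Real.cosh_pos t).le
  set a := Real.tanh s with ha
  set b := Real.tanh (D - s) with hb
  set t := Real.tanh D with ht
  have ha0 : 0 ≤ a := htanh _ hs0
  have hb0 : 0 ≤ b := htanh _ (sub_nonneg.2 hs)
  have ht0 : 0 ≤ t := htanh _ (hs0.trans hs)
  have ha1 : a < 1 := Real.tanh_lt_one s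
  have hb1 : b < 1 := Real.tanh_lt_one _
  have ht1 : t < 1 := Real.tanh_lt_one _
  obtain ⟨A, B, hA, h0, hu⟩ := exists_isDiscAut (u := (t : ℂ)) hx hy 
    (by rw [Complex.norm_real, Real.norm_of_nonneg ht0])
  have had : (a : ℂ) ∈ unitDisc := by simp [mem_unitDisc, abs_of_nonneg ha0, ha1]
  have htd : (t : ℂ) ∈ unitDisc := by simp [mem_unitDisc, abs_of_nonneg ht0, ht1]
  have hpos : 0 < 1 + a * b := by positivity
  have htab : t = (a + b) / (1 + a * b) := by
    refine Real.artanh_injOn ⟨by linarith, ht1⟩ ⟨by linarith [show 0 ≤ (a + b) / (1 + a * b) by positivity], ?_⟩ ?_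
    · rw [div_lt_one hpos]; nlinarith
    · rw [← artanh_add ha0 ha1 hb0 hb1, ha, hb, ht, Real.artanh_tanh, Real.artanh_tanh,
        Real.artanh_tanh]
      ring
  refine ⟨A a, hA.mapsTo had, ?_, ?_⟩
  · rw [← h0, hA.dist_eq _ zero_mem_unitDisc _ had, poincareDist_zero_left, Complex.norm_real,
      Real.norm_of_nonneg ha0, ha, Real.artanh_tanh]
  · rw [← hu, poincareDist_comm, hA.dist_eq _ htd _ had]
    have hab : 1 - a * t ≠ 0 := by nlinarith
    have : ((t : ℂ) - a) / (1 - conj (a : ℂ) * t) = (b : ℂ) := by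
      rw [Complex.conj_ofReal]
      norm_cast
      rw [div_eq_iff hab, htab]
      field_simp
      ring
    rw [poincareDist, this, Complex.norm_real, Real.norm_of_nonneg hb0, hb, Real.artanh_tanh]

/-- A self-map of the disc that is bounded at a fixed scale is Lipschitz at large scales. -/
theorem poincareDist_le_of_local {h : ℂ → ℂ} (hmaps : MapsTo h unitDisc unitDisc) {δ C : ℝ}
    (hδ : 0 < δ) (hC : 0 ≤ C)
    (hloc : ∀ x ∈ unitDisc, ∀ y ∈ unitDisc, poincareDist x y ≤ δ → poincareDist (h x) (h y) ≤ C)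
    {x y : ℂ} (hx : x ∈ unitDisc) (hy : y ∈ unitDisc) :
    poincareDist (h x) (h y) ≤ C / δ * poincareDist x y + C := by
  have key : ∀ n : ℕ, ∀ x ∈ unitDisc, ∀ y ∈ unitDisc, poincareDist x y ≤ (n + 1) * δ →
      poincareDist (h x) (h y) ≤ (n + 1) * C := by
    intro n
    induction n with
    | zero => intro x hx y hy hxy; simpa using hloc x hx y hy (by simpa using hxy)
    | succ n ih =>
      intro x hx y hy hxy
      push_cast at hxy ⊢
      rcases le_or_gt (poincareDist x y) δ with hle | hlt
      · have := hloc x hx y hy hle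
        nlinarith [mul_nonneg (Nat.cast_nonneg (α := ℝ) n) hC]
      -- Peel off a piece of length exactly `δ`; the rest falls under the induction hypothesis.
      · obtain ⟨m, hm, h1, h2⟩ := exists_mem_unitDisc_between hx hy hδ.le hlt.le
        have h3 := hloc x hx m hm h1.le
        have h4 := ih m hm y hy (by rw [h2]; linarith)
        have h5 := poincareDist_triangle (hmaps hx) (hmaps hm) (hmaps hy)
        linarith
  have h1 := key ⌊poincareDist x y / δ⌋₊ x hx y hy
    ((div_le_iff₀ hδ).1 (Nat.lt_floor_add_one _).le)
  have h2 : (⌊poincareDist x y / δ⌋₊ : ℝ) ≤ poincareDist x y / δ :=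
    Nat.floor_le (div_nonneg (poincareDist_nonneg _ _) hδ.le)
  calc _ ≤ _ := h1
    _ ≤ (poincareDist x y / δ + 1) * C := by gcongr
    _ = _ := by ring

/-! ### Distortion and its conformal invariance. -/

theorem det_comp_continuousLinearMap (L M : ℂ →L[ℝ] ℂ) : (L.comp M).det = L.det * M.det := by
  simp [ContinuousLinearMap.det]

theorem det_smul_one (c : ℂ) : (c • (1 : ℂ →L[ℝ] ℂ)).det = ‖c‖ ^ 2 := by
  have h : ((c • (1 : ℂ →L[ℝ] ℂ) : ℂ →L[ℝ] ℂ) : ℂ →ₗ[ℝ] ℂ) = LinearMap.mulLeft ℝ c := by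
    ext; simp
  rw [ContinuousLinearMap.det, h, ← Complex.normSq_eq_norm_sq]
  have := Algebra.norm_complex_apply c
  rwa [Algebra.norm_apply] at this

theorem norm_smul_one_le (c : ℂ) : ‖c • (1 : ℂ →L[ℝ] ℂ)‖ ≤ ‖c‖ :=
  ContinuousLinearMap.opNorm_le_bound _ (norm_nonneg _) fun v => by simp

/-- Distortion is not increased by a holomorphic map on the left. -/
theorem distortion_holo_comp {F h : ℂ → ℂ} {z : ℂ} {K : ℝ}
    (hh : DifferentiableAt ℂ h (F z)) (hF : DifferentiableAt ℝ F z)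
    (hd : ‖fderiv ℝ F z‖ ^ 2 ≤ K * (fderiv ℝ F z).det) :
    ‖fderiv ℝ (h ∘ F) z‖ ^ 2 ≤ K * (fderiv ℝ (h ∘ F) z).det := by
  have h1 := hh.hasDerivAt.complexToReal_fderiv.comp z hF.hasFDerivAt
  rw [h1.fderiv, det_comp_continuousLinearMap, det_smul_one]
  calc _ ≤ (‖deriv h (F z)‖ * ‖fderiv ℝ F z‖) ^ 2 := by
        refine pow_le_pow_left₀ (norm_nonneg _) ((ContinuousLinearMap.opNorm_comp_le _ _).trans ?_) 2
        exact mul_le_mul_of_nonneg_right (norm_smul_one_le _) (norm_nonneg _)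
    _ = ‖deriv h (F z)‖ ^ 2 * ‖fderiv ℝ F z‖ ^ 2 := mul_pow _ _ _
    _ ≤ ‖deriv h (F z)‖ ^ 2 * (K * (fderiv ℝ F z).det) :=
        mul_le_mul_of_nonneg_left hd (sq_nonneg _)
    _ = _ := by ring

/-- Distortion is not increased by a holomorphic map on the right. -/
theorem distortion_comp_holo {F h : ℂ → ℂ} {z : ℂ} {K : ℝ}
    (hh : DifferentiableAt ℂ h z) (hF : DifferentiableAt ℝ F (h z))
    (hd : ‖fderiv ℝ F (h z)‖ ^ 2 ≤ K * (fderiv ℝ F (h z)).det) :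
    ‖fderiv ℝ (F ∘ h) z‖ ^ 2 ≤ K * (fderiv ℝ (F ∘ h) z).det := by
  have h1 := hF.hasFDerivAt.comp z hh.hasDerivAt.complexToReal_fderiv
  rw [h1.fderiv, det_comp_continuousLinearMap, det_smul_one]
  calc _ ≤ (‖fderiv ℝ F (h z)‖ * ‖deriv h z‖) ^ 2 := by
        refine pow_le_pow_left₀ (norm_nonneg _) ((ContinuousLinearMap.opNorm_comp_le _ _).trans ?_) 2
        exact mul_le_mul_of_nonneg_left (norm_smul_one_le _) (norm_nonneg _)
    _ = ‖deriv h z‖ ^ 2 * ‖fderiv ℝ F (h z)‖ ^ 2 := by ring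
    _ ≤ ‖deriv h z‖ ^ 2 * (K * (fderiv ℝ F (h z)).det) :=
        mul_le_mul_of_nonneg_left hd (sq_nonneg _)
    _ = _ := by ring

/-- For `L v = p v + q v̄`, the determinant is `|p|² - |q|²`. With the bound `|p| + |q|` on the
norm, this turns the Wirtinger inequality into a bound on distortion. -/
theorem det_eq_wirtinger (L : ℂ →L[ℝ] ℂ) :
    L.det = ‖(L 1 - Complex.I * L Complex.I) / 2‖ ^ 2
      - ‖(L 1 + Complex.I * L Complex.I) / 2‖ ^ 2 := by
  have h : L.det = (L 1).re * (L Complex.I).im - (L 1).im * (L Complex.I).re := by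
    rw [ContinuousLinearMap.det, ← LinearMap.det_toMatrix Complex.basisOneI, Matrix.det_fin_two]
    simp [LinearMap.toMatrix_apply]
    ring
  rw [h]
  simp only [← Complex.normSq_eq_norm_sq, Complex.normSq_apply]
  simp
  ring

theorem norm_le_wirtinger (L : ℂ →L[ℝ] ℂ) :
    ‖L‖ ≤ ‖(L 1 - Complex.I * L Complex.I) / 2‖ + ‖(L 1 + Complex.I * L Complex.I) / 2‖ := by
  refine L.opNorm_le_bound (by positivity) fun v => ?_
  have h1 : L v = (L 1 - Complex.I * L Complex.I) / 2 * v
      + (L 1 + Complex.I * L Complex.I) / 2 * conj v := by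
    have h2 : v = v.re • (1 : ℂ) + v.im • Complex.I := by
      simp
    have h3 : L v = v.re * L 1 + v.im * L Complex.I := by
      conv_lhs => rw [h2, map_add, map_smul, map_smul]
      simp
    have h4 : v = v.re + v.im * Complex.I := (Complex.re_add_im v).symm
    have h5 : conj v = v.re - v.im * Complex.I := by
      apply Complex.ext <;> simp
    rw [h3, h5]
    linear_combination (-(L 1 - Complex.I * L Complex.I) / 2) * h4
      + (L Complex.I * v.im) * Complex.I_mul_I
  rw [h1, add_mul]
  refine (norm_add_le _ _).trans (le_of_eq ?_)
  rw [norm_mul, norm_mul, Complex.norm_conj]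

/-- A `k`-quasiconformal map has distortion at most `(1 + k) / (1 - k)`. -/
theorem IsQuasiconformalOn.distortion {k : ℝ} {f : ℂ → ℂ} {Ω : Set ℂ}
    (h : IsQuasiconformalOn k f Ω) (hk1 : k < 1) {z : ℂ} (hz : z ∈ Ω) :
    ‖fderiv ℝ f z‖ ^ 2 ≤ (1 + k) / (1 - k) * (fderiv ℝ f z).det := by
  have h1 := h.norm_wirtingerBar_le z hz
  have h2 := norm_le_wirtinger (fderiv ℝ f z)
  rw [det_eq_wirtinger]
  change _ ≤ ‖wirtinger f z‖ + ‖wirtingerBar f z‖ at h2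
  change _ ≤ _ * (‖wirtinger f z‖ ^ 2 - ‖wirtingerBar f z‖ ^ 2)
  set p := ‖wirtinger f z‖
  set q := ‖wirtingerBar f z‖
  have hp : 0 ≤ p := norm_nonneg _
  have hq : 0 ≤ q := norm_nonneg _
  have hk : 0 < 1 - k := by linarith
  rw [div_mul_eq_mul_div, le_div_iff₀ hk]
  have h3 : ‖fderiv ℝ f z‖ ^ 2 ≤ (p + q) ^ 2 := pow_le_pow_left₀ (norm_nonneg _) h2 2
  -- The right side minus the left side is `2 (k p - q)`.
  have h4 : (p + q) * (1 - k) ≤ (1 + k) * (p - q) := by nlinarith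
  calc _ ≤ (p + q) ^ 2 * (1 - k) := mul_le_mul_of_nonneg_right h3 hk.le
    _ = (p + q) * ((p + q) * (1 - k)) := by ring
    _ ≤ (p + q) * ((1 + k) * (p - q)) := mul_le_mul_of_nonneg_left h4 (by positivity)
    _ = _ := by ring

/-! ### Disc homeomorphisms of bounded distortion, and properness. -/

/-- `F` is a homeomorphism of the unit disc of class `C¹` with inverse `G` and distortion at
most `K`. -/
structure IsDiscQC (K : ℝ) (F G : ℂ → ℂ) : Prop where
  mapsTo : MapsTo F unitDisc unitDisc
  mapsTo_inv : MapsTo G unitDisc unitDisc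
  left_inv : ∀ z ∈ unitDisc, G (F z) = z
  right_inv : ∀ z ∈ unitDisc, F (G z) = z
  continuousOn_inv : ContinuousOn G unitDisc
  contDiffOn : ContDiffOn ℝ 1 F unitDisc
  distortion : ∀ z ∈ unitDisc, ‖fderiv ℝ F z‖ ^ 2 ≤ K * (fderiv ℝ F z).det

theorem DifferentiableOn.contDiffOn_real {A : ℂ → ℂ} {U : Set ℂ} (hA : DifferentiableOn ℂ A U)
    (hU : IsOpen U) : ContDiffOn ℝ 1 A U :=
  (hA.contDiffOn hU).restrict_scalars ℝ

namespace IsDiscQC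

variable {K : ℝ} {F G : ℂ → ℂ}

theorem injOn (h : IsDiscQC K F G) : InjOn F unitDisc := fun z hz w hw hzw => by
  rw [← h.left_inv z hz, hzw, h.left_inv w hw]

theorem differentiableAt (h : IsDiscQC K F G) {z : ℂ} (hz : z ∈ unitDisc) :
    DifferentiableAt ℝ F z :=
  (h.contDiffOn.differentiableOn one_ne_zero).differentiableAt (isOpen_unitDisc.mem_nhds hz)

theorem comp_isDiscAut (h : IsDiscQC K F G) {A B : ℂ → ℂ} (hA : IsDiscAut A B) :
    IsDiscQC K (F ∘ A) (B ∘ G) where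
  mapsTo := h.mapsTo.comp hA.mapsTo
  mapsTo_inv := hA.mapsTo_inv.comp h.mapsTo_inv
  left_inv z hz := by simp [h.left_inv _ (hA.mapsTo hz), hA.left_inv z hz]
  right_inv z hz := by simp [hA.right_inv _ (h.mapsTo_inv hz), h.right_inv z hz]
  continuousOn_inv := hA.holo_inv.continuousOn.comp h.continuousOn_inv h.mapsTo_inv
  contDiffOn := h.contDiffOn.comp (hA.holo.contDiffOn_real isOpen_unitDisc) hA.mapsTo
  distortion z hz := distortion_comp_holo
    (hA.holo.differentiableAt (isOpen_unitDisc.mem_nhds hz))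
    (h.differentiableAt (hA.mapsTo hz)) (h.distortion _ (hA.mapsTo hz))

theorem isDiscAut_comp (h : IsDiscQC K F G) {A B : ℂ → ℂ} (hA : IsDiscAut A B) :
    IsDiscQC K (A ∘ F) (G ∘ B) where
  mapsTo := hA.mapsTo.comp h.mapsTo
  mapsTo_inv := h.mapsTo_inv.comp hA.mapsTo_inv
  left_inv z hz := by simp [hA.left_inv _ (h.mapsTo hz), h.left_inv z hz]
  right_inv z hz := by simp [h.right_inv _ (hA.mapsTo_inv hz), hA.right_inv z hz]
  continuousOn_inv := h.continuousOn_inv.comp hA.holo_inv.continuousOn hA.mapsTo_inv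
  contDiffOn := (hA.holo.contDiffOn_real isOpen_unitDisc).comp h.contDiffOn h.mapsTo
  distortion z hz := distortion_holo_comp
    (hA.holo.differentiableAt (isOpen_unitDisc.mem_nhds (h.mapsTo hz)))
    (h.differentiableAt hz) (h.distortion z hz)

end IsDiscQC

/-- A map of the disc with a continuous left inverse is proper. -/
theorem exists_lt_norm_of_lt_norm {F G : ℂ → ℂ} (hF : ContinuousOn F unitDisc)
    (hFm : MapsTo F unitDisc unitDisc) (hFG : ∀ w ∈ unitDisc, F (G w) = w) {r : ℝ} (hr0 : 0 ≤ r)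
    (hr : r < 1) : ∃ ρ < 1, ∀ w ∈ unitDisc, ρ < ‖w‖ → r < ‖G w‖ := by
  have hsub : Metric.closedBall (0 : ℂ) r ⊆ unitDisc := Metric.closedBall_subset_ball hr
  obtain ⟨m, hm, hmax⟩ := (isCompact_closedBall (0 : ℂ) r).exists_isMaxOn
    ⟨0, by simpa using hr0⟩ (hF.mono hsub).norm
  -- `ρ` is the maximum of `|F|` on the closed disc of radius `r`: if `|G w| ≤ r`, then `|w| = |F (G
  -- w)| ≤ ρ`.
  refine ⟨‖F m‖, mem_unitDisc.1 (hFm (hsub hm)), fun w hw hlt => ?_⟩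
  by_contra! hle
  have := hmax (show G w ∈ Metric.closedBall (0 : ℂ) r by simpa using hle)
  simp only [mem_ofPred_eq, hFG w hw] at this
  linarith

/-- Energy form of the length-area inequality for maps with bounded distortion. -/
theorem length_area_of_distortion {g : ℂ → ℂ} {U : Set ℂ} (hU : IsOpen U)
    (hg : ContDiffOn ℝ 1 g U) (hinj : InjOn g U) {K : ℝ} (hK : 0 ≤ K)
    (hdist : ∀ z ∈ U, ‖fderiv ℝ g z‖ ^ 2 ≤ K * (fderiv ℝ g z).det) {V : ℝ} (hV : 0 ≤ V)
    (hvol : volume (g '' U) ≤ ENNReal.ofReal V)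
    {p : ℂ} {a b l : ℝ} (ha : 0 < a) (hab : a ≤ b) (hl : 0 ≤ l)
    (harc : ∀ r ∈ Ioo a b, ∃ s ∈ Icc (-Real.pi) Real.pi, ∃ t ∈ Icc (-Real.pi) Real.pi,
      (∀ x ∈ uIcc s t, circleMap p r x ∈ U) ∧
        l ≤ ‖g (circleMap p r s) - g (circleMap p r t)‖) :
    l ^ 2 / (2 * Real.pi) * Real.log (b / a) ≤ K * V := by
  rw [← ENNReal.ofReal_le_ofReal_iff (mul_nonneg hK hV), ENNReal.ofReal_mul hK]
  exact (length_area hU hg ha hab hl harc).trans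
    ((lintegral_norm_fderiv_sq_le hU hg hinj hK hdist).trans (mul_le_mul_right hvol _))

theorem circleMap_arg_sub (p z : ℂ) : circleMap p ‖z - p‖ (z - p).arg = z := by
  simp [circleMap, Complex.norm_mul_exp_arg_mul_I]

theorem arg_mem_Icc (z : ℂ) : z.arg ∈ Icc (-Real.pi) Real.pi :=
  ⟨(Complex.neg_pi_lt_arg z).le, Complex.arg_le_pi z⟩

/-! ### The two normalized estimates. -/

namespace IsDiscQC

variable {K : ℝ} {F G : ℂ → ℂ}

/-- The preimage of a radial segment `[s u, u)` meets every circle that surrounds its end point. -/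
theorem exists_norm_inv_eq (h : IsDiscQC K F G) {u : ℂ} (hu : ‖u‖ = 1) {s r : ℝ} (hs0 : 0 ≤ s)
    (hs1 : s < 1) (hr : r < 1) (hsr : ‖G (s * u)‖ ≤ r) :
    ∃ t, s ≤ t ∧ t < 1 ∧ ‖G (t * u)‖ = r := by
  obtain ⟨ρ, hρ, hprop⟩ := exists_lt_norm_of_lt_norm h.contDiffOn.continuousOn h.mapsTo
    h.right_inv ((norm_nonneg _).trans hsr) hr
  obtain ⟨t₁, ht₁, ht₁'⟩ := exists_between (max_lt hρ hs1)
  have hst := (le_max_right ρ s).trans ht₁.le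
  have hnorm : ∀ t ∈ Icc s t₁, ‖(t : ℂ) * u‖ = t := fun t ht => by
    rw [norm_mul, hu, mul_one, Complex.norm_real, Real.norm_of_nonneg (hs0.trans ht.1)]
  have hmem : ∀ t ∈ Icc s t₁, (t : ℂ) * u ∈ unitDisc := fun t ht => by
    rw [mem_unitDisc, hnorm t ht]; exact ht.2.trans_lt ht₁'
  have hcont : ContinuousOn (fun t : ℝ => ‖G (t * u)‖) (Icc s t₁) :=
    (h.continuousOn_inv.comp (by fun_prop) hmem).norm
  have ht₁mem : t₁ ∈ Icc s t₁ := ⟨hst, le_rfl⟩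
  obtain ⟨t, ht, hteq⟩ := intermediate_value_Icc hst hcont
    ⟨hsr, (hprop _ (hmem t₁ ht₁mem)
      (by rw [hnorm t₁ ht₁mem]; exact (le_max_left _ _).trans_lt ht₁)).le⟩
  exact ⟨t, ht.1, ht.2.trans_lt ht₁', hteq⟩

theorem volume_le_of_re_im_mem {S : Set ℂ} {a b c d : ℝ} (hab : a ≤ b)
    (hS : ∀ z ∈ S, z.re ∈ Icc a b ∧ z.im ∈ Icc c d) :
    volume S ≤ ENNReal.ofReal ((b - a) * (d - c)) := by
  calc volume S ≤ volume (Complex.measurableEquivRealProd ⁻¹' (Icc a b ×ˢ Icc c d)) :=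
        measure_mono fun z hz => hS z hz
    _ = volume (Icc a b ×ˢ Icc c d) :=
        Complex.volume_preserving_equiv_real_prod.measure_preimage
          (measurableSet_Icc.prod measurableSet_Icc).nullMeasurableSet
    _ = _ := by
        rw [Measure.volume_eq_prod, Measure.prod_prod, Real.volume_Icc, Real.volume_Icc,
          ENNReal.ofReal_mul (sub_nonneg.2 hab)]

/-- If a map fixes the origin and sends a point of modulus at most `1/2` to the positive number
`s`, then `s` is not too close to `1`. -/
theorem log_estimate_image (h : IsDiscQC K F G) (hK : 0 ≤ K) (h0 : F 0 = 0) {z : ℂ}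
    (hz : ‖z‖ ≤ 1 / 2) {s : ℝ} (hs : F z = s) (hs0 : 0 ≤ s) (hs1 : s < 1)
    (hs2 : 0 ≤ -Real.log (2 * (1 - s))) :
    (-Real.log (2 * (1 - s))) ^ 2 / (2 * Real.pi) * Real.log 2 ≤
      K * ((Real.log 3 - Real.log (1 - s)) * Real.pi) := by
  have hzd : z ∈ unitDisc := mem_unitDisc.2 (by linarith)
  have hδ : 0 < 1 - s := by linarith
  -- The branch point `2 - s` lies outside the disc, at distance `1 - s` from it. Hence `log (2 - s
  -- - F)` takes values in a rectangle of width `log 3 - log (1 - s)` and height `π`.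
  have hre : ∀ w ∈ unitDisc, 1 - s < (2 - s - F w).re := fun w hw => by
    have h1 := mem_unitDisc.1 (h.mapsTo hw)
    have h2 := Complex.re_le_norm (F w)
    simp only [Complex.sub_re, Complex.re_ofNat, Complex.ofReal_re]
    linarith
  have hslit : ∀ w ∈ unitDisc, 2 - s - F w ∈ Complex.slitPlane := fun w hw =>
    Or.inl (hδ.trans (hre w hw))
  have hlog3 : Real.log (1 - s) ≤ Real.log 3 := Real.log_le_log hδ (by linarith)
  have hcomp : (fun w => Complex.log (2 - s - F w)) = (fun w => Complex.log (2 - s - w)) ∘ F := rfl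
  have hdiff : ∀ w ∈ unitDisc, DifferentiableAt ℂ (fun w => Complex.log (2 - s - w)) (F w) :=
    fun w hw => DifferentiableAt.clog (by fun_prop) (hslit w hw)
  have hg : ContDiffOn ℝ 1 (fun w => Complex.log (2 - s - F w)) unitDisc := by
    intro w hw
    have h1 := (Complex.contDiffAt_log (n := 1) (hslit w hw)).restrict_scalars ℝ
    exact h1.comp_contDiffWithinAt w (contDiffWithinAt_const.sub (h.contDiffOn w hw))
  have hnorm_le : ∀ w ∈ unitDisc, ‖(2 - s - F w : ℂ)‖ ≤ 3 := fun w hw => by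
    have h1 := mem_unitDisc.1 (h.mapsTo hw)
    have h2 := norm_sub_le (((2 - s : ℝ)) : ℂ) (F w)
    rw [Complex.norm_real, Real.norm_of_nonneg (by linarith)] at h2
    push_cast at h2
    linarith
  have key := length_area_of_distortion (g := fun w => Complex.log (2 - s - F w)) (p := 0)
    (a := 1 / 2) (b := 1) (l := -Real.log (2 * (1 - s))) isOpen_unitDisc hg ?_ hK ?_
    (V := (Real.log 3 - Real.log (1 - s)) * (Real.pi / 2 - -(Real.pi / 2)))
    (mul_nonneg (by linarith) (by linarith [Real.pi_pos])) ?_ (by norm_num) (by norm_num) hs2 ?_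
  · norm_num at key ⊢
    exact key
  · intro w hw w' hw' heq
    have h1 := congrArg Complex.exp heq
    simp only at h1
    rw [Complex.exp_log (Complex.slitPlane_ne_zero (hslit w hw)),
      Complex.exp_log (Complex.slitPlane_ne_zero (hslit w' hw'))] at h1
    exact h.injOn hw hw' (sub_right_injective h1)
  · intro w hw
    rw [hcomp]
    exact distortion_holo_comp (hdiff w hw) (h.differentiableAt hw) (h.distortion w hw)
  · refine volume_le_of_re_im_mem hlog3 ?_
    rintro _ ⟨w, hw, rfl⟩
    simp only [Complex.log_re, Complex.log_im]
    have h1 := (hre w hw).trans_le (Complex.re_le_norm _)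
    refine ⟨⟨Real.log_le_log hδ h1.le, Real.log_le_log (hδ.trans h1) (hnorm_le w hw)⟩, ?_⟩
    exact abs_le.1 (Complex.abs_arg_le_pi_div_two_iff.2 (hδ.trans (hre w hw)).le)
  · intro r hr
    have hG0 : G 0 = 0 := by rw [← h0, h.left_inv 0 zero_mem_unitDisc, h0]
    -- The preimages of `[s, 1)` and `(-1, 0]` start at `z` and `0`, in the closed disc of radius
    -- `1/2`, and run out to the unit circle, so both meet the circle of radius `r`.
    obtain ⟨t₁, ht₁, ht₁', hr₁⟩ := h.exists_norm_inv_eq (u := 1) (s := s) (r := r) (by simp) hs0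
      hs1 hr.2 (by rw [mul_one, ← hs, h.left_inv z hzd]; exact hz.trans hr.1.le)
    obtain ⟨t₂, ht₂, ht₂', hr₂⟩ := h.exists_norm_inv_eq (u := -1) (s := 0) (r := r) (by simp) le_rfl
      one_pos hr.2 (by simp only [Complex.ofReal_zero, zero_mul, hG0, norm_zero]; linarith [hr.1])
    have hd₁ : (t₁ : ℂ) * 1 ∈ unitDisc := by
      simpa [mem_unitDisc, abs_of_nonneg (hs0.trans ht₁)] using ht₁'
    have hd₂ : (t₂ : ℂ) * -1 ∈ unitDisc := by
      simpa [mem_unitDisc, abs_of_nonneg ht₂] using ht₂'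
    have e₁ := circleMap_arg_sub 0 (G (t₁ * 1))
    have e₂ := circleMap_arg_sub 0 (G (t₂ * -1))
    rw [sub_zero, hr₁] at e₁
    rw [sub_zero, hr₂] at e₂
    refine ⟨_, arg_mem_Icc (G (t₁ * 1)), _, arg_mem_Icc (G (t₂ * -1)), fun x _ => ?_, ?_⟩
    swap
    · rw [e₁, e₂, h.right_inv _ hd₁, h.right_inv _ hd₂, norm_sub_rev]
      refine le_trans ?_ (Complex.re_le_norm _)
      rw [Complex.sub_re, Complex.log_re, Complex.log_re]
      have h1 : (2 - s - t₂ * -1 : ℂ) = ((2 - s + t₂ : ℝ) : ℂ) := by push_cast; ring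
      have h2 : (2 - s - t₁ * 1 : ℂ) = ((2 - s - t₁ : ℝ) : ℂ) := by push_cast; ring
      rw [h1, h2, Complex.norm_real, Complex.norm_real, Real.norm_of_nonneg (by linarith),
        Real.norm_of_nonneg (by linarith)]
      -- The real parts of the logarithms alone give the length: one is at least `0`, the other at
      -- most `log (2 (1 - s))`.
      have h3 : 0 ≤ Real.log (2 - s + t₂) := Real.log_nonneg (by linarith)
      have h4 : Real.log (2 - s - t₁) ≤ Real.log (2 * (1 - s)) :=
        Real.log_le_log (by linarith) (by linarith)
      linarith
    · rw [mem_unitDisc, norm_circleMap_zero, abs_lt]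
      exact ⟨by linarith [hr.1], hr.2⟩

theorem norm_circleMap_neg_one_sq (r x : ℝ) :
    ‖circleMap (-1) r x‖ ^ 2 = 1 - r * (2 * Real.cos x - r) := by
  have h1 : circleMap (-1) r x = ((-1 + r * Real.cos x : ℝ) : ℂ) + (r * Real.sin x : ℝ) * Complex.I := by
    rw [circleMap, Complex.exp_mul_I]
    push_cast
    ring
  rw [h1, ← Complex.normSq_eq_norm_sq, Complex.normSq_add_mul_I]
  linear_combination r ^ 2 * Real.sin_sq_add_cos_sq x

/-- For `r < 2` and angles in `[-π, π]`, the circle about `-1` meets the disc in the single arc `|x|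
< arccos (r / 2)`, away from the cut of polar coordinates. -/
theorem circleMap_neg_one_mem_unitDisc_iff {r x : ℝ} (hr : 0 < r) :
    circleMap (-1) r x ∈ unitDisc ↔ r / 2 < Real.cos x := by
  rw [mem_unitDisc, ← sq_lt_one_iff₀ (norm_nonneg _), norm_circleMap_neg_one_sq]
  constructor <;> intro h
  · have : 0 < 2 * Real.cos x - r := by
      by_contra! h'
      nlinarith
    linarith
  · nlinarith [mul_pos hr (show 0 < 2 * Real.cos x - r by linarith)]

/-- If a map fixes the origin and sends `-t` into the disc of radius `1/2`, then `t` is not too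
close to `1`. -/
theorem log_estimate_preimage (h : IsDiscQC K F G) (hK : 0 ≤ K) (h0 : F 0 = 0) {t : ℝ}
    (ht0 : 0 ≤ t) (ht1 : t < 1) (ht : ‖F (-t)‖ ≤ 1 / 2) :
    (1 / 4) ^ 2 / (2 * Real.pi) * Real.log (1 / (1 - t)) ≤ K * Real.pi := by
  have htd : (-t : ℂ) ∈ unitDisc := by simpa [mem_unitDisc, abs_of_nonneg ht0] using ht1
  refine length_area_of_distortion (g := F) (p := -1) isOpen_unitDisc h.contDiffOn h.injOn hK
    h.distortion Real.pi_pos.le ?_ (by linarith) (by linarith) (by norm_num) ?_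
  · refine (measure_mono h.mapsTo.image_subset).trans ?_
    simp [unitDisc, ENNReal.ofReal_eq_coe_nnreal Real.pi_pos.le, NNReal.pi]
    rfl
  · intro r hr
    have hr0 : 0 < r := by linarith [hr.1]
    -- Properness replaces boundary values of `F`. Any level strictly between `1/2` and `1` would
    -- do; `3/4` gives the length `3/4 - 1/2 = 1/4`.
    obtain ⟨ρ, hρ, hprop⟩ := exists_lt_norm_of_lt_norm h.continuousOn_inv h.mapsTo_inv
      h.left_inv (r := 3 / 4) (by norm_num) (by norm_num)
    -- the preimage of the segment from `F (-t)` to `0` meets the circle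
    obtain ⟨ζ, hζd, hζ, hFζ⟩ : ∃ ζ ∈ unitDisc, ‖ζ - -1‖ = r ∧ ‖F ζ‖ ≤ 1 / 2 := by
      have hle : ∀ τ ∈ Icc (0 : ℝ) 1, ‖(τ : ℂ) * F (-t)‖ ≤ 1 / 2 := fun τ hτ => by
        rw [norm_mul, Complex.norm_real, Real.norm_of_nonneg hτ.1]
        nlinarith [hτ.1, hτ.2, norm_nonneg (F (-t))]
      have hmem : ∀ τ ∈ Icc (0 : ℝ) 1, (τ : ℂ) * F (-t) ∈ unitDisc := fun τ hτ =>
        mem_unitDisc.2 (by linarith [hle τ hτ])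
      have hcont : ContinuousOn (fun τ : ℝ => ‖G (τ * F (-t)) - -1‖) (Icc 0 1) :=
        ((h.continuousOn_inv.comp (by fun_prop) hmem).sub continuousOn_const).norm
      have hG0 : G 0 = 0 := by rw [← h0, h.left_inv 0 zero_mem_unitDisc, h0]
      have h1 : ‖G ((1 : ℝ) * F (-t)) - -1‖ = 1 - t := by
        rw [Complex.ofReal_one, one_mul, h.left_inv _ htd]
        have : (-t - -1 : ℂ) = ((1 - t : ℝ) : ℂ) := by push_cast; ring
        rw [this, Complex.norm_real, Real.norm_of_nonneg (by linarith)]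
      have h2 : ‖G ((0 : ℝ) * F (-t)) - -1‖ = 1 := by simp [hG0]
      obtain ⟨τ, hτ, hτr⟩ := intermediate_value_Icc' zero_le_one hcont (show r ∈ Icc _ _ by
        rw [h1, h2]; exact ⟨hr.1.le, hr.2.le⟩)
      exact ⟨_, h.mapsTo_inv (hmem τ hτ), hτr, by rw [h.right_inv _ (hmem τ hτ)]; exact hle τ hτ⟩
    have e₁ := circleMap_arg_sub (-1) ζ
    rw [hζ] at e₁
    set θ := (ζ - -1).arg with hθ
    have hθI : θ ∈ Icc (-Real.pi) Real.pi := arg_mem_Icc _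
    have hcosθ : r / 2 < Real.cos θ := (circleMap_neg_one_mem_unitDisc_iff hr0).1 (by rwa [e₁])
    set α := Real.arccos (r / 2) with hα
    have hcosα : Real.cos α = r / 2 := Real.cos_arccos (by linarith) (by linarith [hr.2])
    have hαpi : α ≤ Real.pi := Real.arccos_le_pi _
    have hθα : |θ| < α := by
      by_contra! hle
      have := Real.cos_le_cos_of_nonneg_of_le_pi (Real.arccos_nonneg _) (abs_le.2 hθI) hle
      rw [Real.cos_abs, ← hα, hcosα] at this
      linarith
    -- a point of the arc close to its end point on the unit circle
    obtain ⟨x, hx, hxρ⟩ : ∃ x ∈ Ioo |θ| α, ρ < ‖circleMap (-1) r x‖ := by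
      have hnorm : ‖circleMap (-1) r α‖ = 1 := by
        rw [← pow_eq_one_iff_of_nonneg (norm_nonneg _) two_ne_zero, norm_circleMap_neg_one_sq,
          hcosα]
        ring
      have hev : ∀ᶠ x in 𝓝[<] α, ρ < ‖circleMap (-1) r x‖ :=
        ((continuous_circleMap (-1) r).norm.continuousWithinAt).eventually_const_lt
          (hρ.trans_eq hnorm.symm)
      exact ((eventually_mem_set.2 (Ioo_mem_nhdsLT hθα)).and hev).exists
    have harc : ∀ y, |y| ≤ x → circleMap (-1) r y ∈ unitDisc := fun y hy => by
      rw [circleMap_neg_one_mem_unitDisc_iff hr0, ← hcosα, ← Real.cos_abs y]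
      exact Real.cos_lt_cos_of_nonneg_of_le_pi (abs_nonneg y) hαpi (hy.trans_lt hx.2)
    have hx0 : 0 ≤ x := (abs_nonneg θ).trans hx.1.le
    refine ⟨θ, hθI, x, ⟨by linarith [Real.pi_pos], hx.2.le.trans hαpi⟩, fun y hy => harc y ?_, ?_⟩
    · rw [uIcc_of_le ((le_abs_self θ).trans hx.1.le)] at hy
      exact abs_le.2 ⟨by linarith [neg_abs_le θ, hx.1, hy.1], hy.2⟩
    · rw [e₁, norm_sub_rev]
      have h1 := hprop _ (harc x (by rw [abs_of_nonneg hx0])) hxρ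
      have h2 := norm_sub_norm_le (F (circleMap (-1) r x)) (F ζ)
      linarith

end IsDiscQC

/-! ### From the normalized estimates to the quasi-isometry. -/

theorem artanh_le_log {s : ℝ} (hs0 : 0 ≤ s) (hs1 : s < 1) :
    Real.artanh s ≤ 1 / 2 * (Real.log 2 - Real.log (1 - s)) := by
  have h1 : 0 < 1 - s := by linarith
  rw [Real.artanh_eq_half_log ⟨by linarith, hs1.le⟩, ← Real.log_div two_ne_zero h1.ne']
  gcongr
  linarith

theorem tanh_le_half {d : ℝ} (hd : d ≤ Real.artanh (1 / 2)) : Real.tanh d ≤ 1 / 2 := by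
  have h := Real.strictMonoOn_artanh.le_iff_le (a := Real.tanh d) (b := 1 / 2)
    ⟨Real.neg_one_lt_tanh d, Real.tanh_lt_one d⟩ ⟨by norm_num, by norm_num⟩
  rw [← h, Real.artanh_tanh]
  exact hd

theorem tanh_poincareDist_nonneg {z w : ℂ} (hz : z ∈ unitDisc) (hw : w ∈ unitDisc) :
    0 ≤ Real.tanh (poincareDist z w) := by
  rw [tanh_poincareDist hz hw]; exact norm_nonneg _

namespace IsDiscQC

variable {K : ℝ} {F G : ℂ → ℂ}

theorem poincareDist_le_of_le (h : IsDiscQC K F G) (hK : 0 ≤ K) {z w : ℂ} (hz : z ∈ unitDisc)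
    (hw : w ∈ unitDisc) (hzw : poincareDist z w ≤ Real.artanh (1 / 2)) :
    poincareDist (F z) (F w) ≤ 1 / 2 * (5 + 4 * Real.pi ^ 2 * K / Real.log 2) := by
  obtain ⟨A, B, hA, hA0, hAw⟩ := exists_isDiscAut
    (u := (Real.tanh (poincareDist z w) : ℂ)) hz hw
    (by rw [Complex.norm_real,
      Real.norm_of_nonneg (tanh_poincareDist_nonneg hz hw)])
  set t := Real.tanh (poincareDist z w) with ht
  have ht0 : 0 ≤ t := tanh_poincareDist_nonneg hz hw
  have hFz := h.mapsTo hz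
  have hFw := h.mapsTo hw
  set s := Real.tanh (poincareDist (F z) (F w)) with hs
  have hs0 : 0 ≤ s := tanh_poincareDist_nonneg hFz hFw
  have hs1 : s < 1 := Real.tanh_lt_one _
  obtain ⟨A', B', hA', hA0', hAw'⟩ := exists_isDiscAut (u := (s : ℂ)) hFz hFw
    (by rw [Complex.norm_real, Real.norm_of_nonneg hs0])
  have hsd : (s : ℂ) ∈ unitDisc := by simpa [mem_unitDisc, abs_of_nonneg hs0] using hs1
  have hd : poincareDist (F z) (F w) = Real.artanh s := by rw [hs, Real.artanh_tanh]
  have hlog2 : 0 < Real.log 2 := Real.log_pos one_lt_two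
  have hlog2' : Real.log 2 ≤ 1 := by linarith [Real.log_le_sub_one_of_pos (x := 2) two_pos]
  have hlog3 : Real.log 3 ≤ 2 := by linarith [Real.log_le_sub_one_of_pos (x := 3) three_pos]
  have hq : 0 ≤ 4 * Real.pi ^ 2 * K / Real.log 2 := by positivity
  have hδ : 0 < 1 - s := by linarith
  set y := -Real.log (2 * (1 - s)) with hy
  have hys : Real.log (1 - s) = -y - Real.log 2 := by
    rw [hy, Real.log_mul two_ne_zero hδ.ne']; ring
  have hbound := artanh_le_log hs0 hs1
  rw [hd]
  -- Since `artanh s ≤ (y + 2 log 2) / 2` and `log 2 ≤ 1`, this gives the constant `5 = 3 + 2`.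
  suffices y ≤ 3 + 4 * Real.pi ^ 2 * K / Real.log 2 by
    rw [hys] at hbound; linarith
  -- Beyond `3 ≥ log 3 + log 2`, the area factor `y + log 3 + log 2` is at most `2 y`, so the
  -- quadratic inequality can be divided by `y`.
  rcases le_or_gt y 3 with h3 | h3
  · linarith
  have hQC := (h.comp_isDiscAut hA).isDiscAut_comp hA'.symm
  have key := hQC.log_estimate_image hK (z := (t : ℂ)) (s := s)
    (by simp only [Function.comp, hA0]; rw [← hA0', hA'.left_inv 0 zero_mem_unitDisc])
    (by rw [Complex.norm_real, Real.norm_of_nonneg ht0]; exact tanh_le_half hzw)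
    (by
      simp only [Function.comp]
      rw [show A t = w from hAw, ← hAw', hA'.left_inv _ hsd])
    hs0 hs1 (by linarith)
  rw [← hy, hys, div_mul_eq_mul_div, div_le_iff₀ (by positivity)] at key
  have h4 : K * ((Real.log 3 - (-y - Real.log 2)) * Real.pi) ≤ K * (2 * y * Real.pi) := by
    gcongr
    linarith
  have h5 : y ^ 2 * Real.log 2 ≤ 4 * Real.pi ^ 2 * K * y := by
    nlinarith [mul_le_mul_of_nonneg_right h4 (show 0 ≤ 2 * Real.pi by positivity)]
  have h6 : y * Real.log 2 ≤ 4 * Real.pi ^ 2 * K := by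
    refine le_of_mul_le_mul_right ?_ (show 0 < y by linarith)
    linarith
  have h7 := (le_div_iff₀ hlog2).2 h6
  linarith

/-- This is the local bound for `G`, obtained from the regularity of `F` alone. The second point is
normalized to `-t`, so that the circles about `-1` of radius in `(1 - t, 1)` separate it from `0`.
-/
theorem poincareDist_le_of_image_le (h : IsDiscQC K F G) (hK : 0 ≤ K) {z w : ℂ}
    (hz : z ∈ unitDisc) (hw : w ∈ unitDisc)
    (hzw : poincareDist (F z) (F w) ≤ Real.artanh (1 / 2)) :
    poincareDist z w ≤ 1 / 2 * (1 + 32 * Real.pi ^ 2 * K) := by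
  set t := Real.tanh (poincareDist z w) with ht
  have ht0 : 0 ≤ t := tanh_poincareDist_nonneg hz hw
  have ht1 : t < 1 := Real.tanh_lt_one _
  obtain ⟨A, B, hA, hA0, hAw⟩ := exists_isDiscAut (u := (-t : ℂ)) hz hw
    (by rw [norm_neg, Complex.norm_real, Real.norm_of_nonneg ht0])
  have hFz := h.mapsTo hz
  have hFw := h.mapsTo hw
  have hA' := isDiscAut_moebius hFz
  have hQC := (h.comp_isDiscAut hA).isDiscAut_comp hA'
  have key := hQC.log_estimate_preimage hK (t := t)
    (by simp [Function.comp, hA0, moebius]) ht0 ht1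
    (by
      simp only [Function.comp, hAw]
      rw [moebius, ← tanh_poincareDist hFw hFz, poincareDist_comm]
      exact tanh_le_half hzw)
  have hbound := artanh_le_log ht0 ht1
  have hd : poincareDist z w = Real.artanh t := by rw [ht, Real.artanh_tanh]
  rw [one_div (1 - t), Real.log_inv, div_mul_eq_mul_div, div_le_iff₀ (by positivity)] at key
  have hlog2' : Real.log 2 ≤ 1 := by linarith [Real.log_le_sub_one_of_pos (x := 2) two_pos]
  rw [hd]
  nlinarith

/-- Homeomorphisms of the disc with distortion at most `K` are quasi-isometries. -/
theorem exists_isQuasiIsometryOnWith (K : ℝ) (hK : 0 ≤ K) :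
    ∃ lam : ℝ, 0 < lam ∧ ∃ c : ℝ, 0 < c ∧ ∀ F G, IsDiscQC K F G →
      IsQuasiIsometryOnWith poincareDist poincareDist lam c F unitDisc := by
  set δ := Real.artanh (1 / 2) with hδ
  have hδ0 : 0 < δ := Real.artanh_pos ⟨by norm_num, by norm_num⟩
  set C₁ := 1 / 2 * (5 + 4 * Real.pi ^ 2 * K / Real.log 2) with hC₁
  set C₂ := 1 / 2 * (1 + 32 * Real.pi ^ 2 * K) with hC₂
  have hlog2 : 0 < Real.log 2 := Real.log_pos one_lt_two
  have h1 : 0 < C₁ := by positivity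
  have h2 : 0 < C₂ := by positivity
  set lam := max (C₁ / δ) (C₂ / δ) with hlam
  have hlam0 : 0 < lam := lt_max_of_lt_left (by positivity)
  -- Solving the bound for `G` for the distance between the images divides its additive constant
  -- `C₂` by `lam`.
  refine ⟨lam, hlam0, max C₁ (C₂ / lam), lt_max_of_lt_left h1, fun F G h x hx y hy => ?_⟩
  have hu := poincareDist_le_of_local h.mapsTo hδ0 h1.le
    (fun x hx y hy hxy => h.poincareDist_le_of_le hK hx hy hxy) hx hy
  have hl := poincareDist_le_of_local h.mapsTo_inv hδ0 h2.le
    (fun x hx y hy hxy => h.poincareDist_le_of_image_le hK (h.mapsTo_inv hx) (h.mapsTo_inv hy)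
      (by rwa [h.right_inv x hx, h.right_inv y hy])) (h.mapsTo hx) (h.mapsTo hy)
  rw [h.left_inv x hx, h.left_inv y hy] at hl
  have hn := poincareDist_nonneg (F x) (F y)
  have hn' := poincareDist_nonneg x y
  constructor
  · have h3 : poincareDist x y ≤ lam * poincareDist (F x) (F y) + C₂ :=
      hl.trans (by gcongr; exact le_max_right _ _)
    have h4 : 1 / lam * poincareDist x y ≤ poincareDist (F x) (F y) + C₂ / lam := by
      rw [one_div_mul_eq_div, div_le_iff₀ hlam0, add_mul, div_mul_cancel₀ _ hlam0.ne']
      linarith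
    linarith [le_max_right C₁ (C₂ / lam)]
  · refine hu.trans ?_
    gcongr
    · exact le_max_left _ _
    · exact le_max_left _ _

end IsDiscQC

/-- For `0 ≤ k < 1`, the `k`-quasiconformal homeomorphisms of the unit disc onto itself are
quasi-isometries for the Poincaré distance, with constants that depend only on `k`.
A homeomorphism of the disc is a partial homeomorphism of `ℂ` with source and target the disc;
its values off the disc play no role. -/
theorem mainTheorem2 (k : ℝ) (hk0 : 0 ≤ k) (hk1 : k < 1) :
    ∃ lam : ℝ, 0 < lam ∧ ∃ c : ℝ, 0 < c ∧
      ∀ f : OpenPartialHomeomorph ℂ ℂ, f.source = unitDisc → f.target = unitDisc →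
        IsQuasiconformalOn k f unitDisc →
          IsQuasiIsometryOnWith poincareDist poincareDist lam c f unitDisc := by
  obtain ⟨lam, hlam, c, hc, h⟩ := IsDiscQC.exists_isQuasiIsometryOnWith ((1 + k) / (1 - k))
    (div_nonneg (by linarith) (by linarith))
  refine ⟨lam, hlam, c, hc, fun f hs ht hf => h f f.symm ?_⟩
  exact
    { mapsTo := fun z hz => ht ▸ f.map_source (hs ▸ hz)
      mapsTo_inv := fun z hz => hs ▸ f.map_target (ht ▸ hz)
      left_inv := fun z hz => f.left_inv (hs ▸ hz)
      right_inv := fun z hz => f.right_inv (ht ▸ hz)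
      continuousOn_inv := ht ▸ f.continuousOn_symm
      contDiffOn := hf.contDiffOn
      distortion := fun z hz => hf.distortion hk1 hz }
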